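/- Let $D$ be a directed multigraph with finite vertex set $V(D)$ (loops and parallel edges are allowed), let $X \subseteq V(D)$, and let $k \geq 0$ be an integer. An $X$-path is a directed path in $D$ with at least one edge and without repeated vertices whose first and last vertices lie in $X$ and which contains no other vertex of $X$. Then $D$ admits $k$ pairwise (vertex-)disjoint $X$-paths if and only if all $S, T \subseteq V(D)$ with $X \cap S = X \cap T$ satisfy $$|S \cap T| + \sum_{C} \left\lfloor \tfrac{1}{2} |V(C) \cap (X \cup S \cup T)| \right\rfloor \geq k,$$ where $C$ ranges over the weak components of the spanning directed submultigraph of $D$ obtained by deleting every edge whose terminal vertex lies in $S$ and every edge whose initial vertex lies in $T$. -/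

import Mathlib

/-!
A directed multigraph with vertex set `V` is a `Quiver` on `V`: for every ordered pair `(a, b)` of
vertices the type `a ⟶ b` of edges from `a` to `b`. Loops and parallel edges are allowed.
-/

namespace DirMultigraph

variable {V : Type*} [Quiver V]

/-- An `X`-path: a non-trivial directed path (without repeated vertices) whose two endvertices lie
in `X` and which contains no other vertex of `X`. A `Quiver.Path` is a directed walk, that is, a
finite sequence of consecutive directed edges. -/
structure XPath (X : Set V) where
  /-- the first vertex -/
  first : V
  /-- the last vertex -/
  last : V
  /-- the underlying directed walk -/
  walk : Quiver.Path first last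
  nodup : walk.vertices.Nodup
  nontrivial : 0 < walk.length
  first_mem : first ∈ X
  last_mem : last ∈ X
  eq_of_mem : ∀ v ∈ walk.vertices, v ∈ X → v = first ∨ v = last

/-- The set of vertices of an `X`-path. -/
def XPath.vertexSet {X : Set V} (P : XPath X) : Set V := {v | v ∈ P.walk.vertices}

/-- The set of edges arriving in `S`. -/
def edgesInto (S : Set V) : WideSubquiver V := fun _ b => {_e | b ∈ S}

/-- The set of edges leaving `T`. -/
def edgesOutOf (T : Set V) : WideSubquiver V := fun a _ => {_e | a ∈ T}

/-- The spanning subgraph obtained by deleting the edges that arrive in `S` and the edges that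
leave `T`. -/
def deleteInOut (S T : Set V) : WideSubquiver V :=
  fun a b => (edgesInto S a b ∪ edgesOutOf T a b)ᶜ

/-- The vertex set of a weak component of a spanning subgraph, as a set of vertices of the whole
graph. -/
def componentVertices {H : WideSubquiver V} (C : Quiver.WeaklyConnectedComponent H) : Set V :=
  {v | Quiver.WeaklyConnectedComponent.mk (V := H) v = C}

end DirMultigraph

namespace DirMultigraph

section Counting

variable {V ι C : Type*} [Finite V] [Finite C]

/-- A family of disjoint sets each of which meets `Z` or contains two elements of `W` of the same
class has at most `|Z| + ∑ ⌊|class ∩ W| / 2⌋` members. -/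
theorem card_le_of_disjoint_family [Finite ι] (cls : V → C) (Z W : Set V) (A : ι → Set V)
    (hA : Pairwise fun i j => Disjoint (A i) (A j))
    (h : ∀ i, (∃ v ∈ A i, v ∈ Z) ∨
      ∃ x ∈ A i, ∃ y ∈ A i, x ≠ y ∧ x ∈ W ∧ y ∈ W ∧ cls x = cls y) :
    Nat.card ι ≤ Z.ncard + ∑ᶠ c : C, ({v | cls v = c} ∩ W).ncard / 2 := by
  classical
  have := Fintype.ofFinite ι
  have := Fintype.ofFinite C
  rcases isEmpty_or_nonempty ι with hι | ⟨⟨i₀⟩⟩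
  · simp
  have : Nonempty V := (h i₀).elim (fun ⟨v, _⟩ => ⟨v⟩) (fun ⟨v, _⟩ => ⟨v⟩)
  have heq : ∀ i j v, v ∈ A i → v ∈ A j → i = j := fun i j v hi hj => by
    by_contra hne
    exact Set.disjoint_left.1 (hA hne) hi hj
  rw [finsum_eq_sum_of_fintype, Nat.card_eq_fintype_card, ← Finset.card_univ,
    ← Finset.card_filter_add_card_filter_not (s := Finset.univ) (fun i => ∃ v ∈ A i, v ∈ Z)]
  apply add_le_add
  · have hm : ∀ i ∈ Finset.univ.filter (fun i => ∃ v ∈ A i, v ∈ Z), ∃ v, v ∈ A i ∧ v ∈ Z := by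
      intro i hi
      simpa using hi
    choose! f hf using hm
    rw [← Set.ncard_coe_finset]
    refine Set.ncard_le_ncard_of_injOn f (fun i hi => (hf i hi).2) ?_ (Set.toFinite _)
    intro i hi j hj hij
    exact heq i j (f i) (hf i hi).1 (hij ▸ (hf j hj).1)
  · have hm : ∀ i ∈ Finset.univ.filter (fun i => ¬ ∃ v ∈ A i, v ∈ Z), ∃ f : Bool → V,
        Function.Injective f ∧ ∀ b, f b ∈ A i ∧ f b ∈ W ∧ cls (f b) = cls (f true) := by
      intro i hi
      obtain ⟨x, hx, y, hy, hne, hxW, hyW, hc⟩ := (h i).resolve_left (by simpa using hi)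
      refine ⟨fun b => if b then x else y, ?_, ?_⟩
      · intro a b hab
        cases a <;> cases b <;> simp_all
      · intro b
        cases b <;> simp_all
    choose! f hinj hf using hm
    rw [Finset.card_eq_sum_card_fiberwise (f := fun i => cls (f i true)) (t := Finset.univ)
      (fun _ _ => Finset.mem_coe.2 (Finset.mem_univ _))]
    refine Finset.sum_le_sum fun c _ => ?_
    rw [Nat.le_div_iff_mul_le two_pos]
    set J := {a ∈ Finset.univ.filter (fun i => ¬ ∃ v ∈ A i, v ∈ Z) | cls (f a true) = c} with hJ
    have : (J ×ˢ (Finset.univ : Finset Bool)).card = J.card * 2 := by simp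
    rw [← this, ← Set.ncard_coe_finset]
    refine Set.ncard_le_ncard_of_injOn (fun p => f p.1 p.2) ?_ ?_ (Set.toFinite _)
    · rintro ⟨i, b⟩ hib
      have hi : i ∈ J := by simpa using hib
      obtain ⟨hi, hc⟩ := Finset.mem_filter.1 hi
      exact ⟨((hf i hi b).2.2).trans hc, (hf i hi b).2.1⟩
    · rintro ⟨i, b⟩ hib ⟨j, b'⟩ hjb hij
      have hi : i ∈ J := by simpa using hib
      have hj : j ∈ J := by simpa using hjb
      have hi := (Finset.mem_filter.1 hi).1
      have hj := (Finset.mem_filter.1 hj).1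
      dsimp only at hij
      obtain rfl := heq i j (f i b) (hf i hi b).1 (hij ▸ (hf j hj b').1)
      rw [hinj i hi hij]

/-- A lower bound for `∑ ⌊|class ∩ W| / 2⌋` bounds the number of classes meeting `W` in an odd
number of elements. -/
theorem card_odd_classes_le (cls : V → C) (W : Set V) (k z : ℕ)
    (h : k ≤ z + ∑ᶠ c : C, ({v | cls v = c} ∩ W).ncard / 2) :
    2 * k + {c : C | Odd ({v | cls v = c} ∩ W).ncard}.ncard ≤ 2 * z + W.ncard := by
  classical
  have := Fintype.ofFinite C
  have := Fintype.ofFinite V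
  rw [finsum_eq_sum_of_fintype] at h
  have hW : W.ncard = ∑ c : C, ({v | cls v = c} ∩ W).ncard := by
    rw [Set.ncard_eq_toFinset_card' W,
      Finset.card_eq_sum_card_fiberwise (f := cls) (t := Finset.univ)
      (fun _ _ => Finset.mem_coe.2 (Finset.mem_univ _))]
    refine Finset.sum_congr rfl fun c _ => ?_
    rw [← Set.ncard_coe_finset]
    congr 1
    ext v
    simp [and_comm]
  have hO : {c : C | Odd ({v | cls v = c} ∩ W).ncard}.ncard =
      ∑ c : C, ({v | cls v = c} ∩ W).ncard % 2 := by
    rw [Set.ncard_eq_toFinset_card', Set.toFinset_ofPred, Finset.card_filter]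
    refine Finset.sum_congr rfl fun c _ => ?_
    split_ifs with hc
    · exact (Nat.odd_iff.1 hc).symm
    · exact (Nat.even_iff.1 (Nat.not_odd_iff_even.1 hc)).symm
  have hs : ∑ c : C, ({v | cls v = c} ∩ W).ncard =
      2 * (∑ c : C, ({v | cls v = c} ∩ W).ncard / 2) +
        ∑ c : C, ({v | cls v = c} ∩ W).ncard % 2 := by
    rw [Finset.mul_sum, ← Finset.sum_add_distrib]
    exact Finset.sum_congr rfl fun c _ => (Nat.div_add_mod _ 2).symm
  omega

end Counting

section Components

variable {V : Type*} [Quiver V]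

/-- The weak component of a vertex after deleting the edges into `S` and the edges out of `T`. -/
def componentOf (S T : Set V) (v : V) : Quiver.WeaklyConnectedComponent (deleteInOut S T) :=
  Quiver.WeaklyConnectedComponent.mk (V := deleteInOut S T) v

theorem componentVertices_eq (S T : Set V)
    (C : Quiver.WeaklyConnectedComponent (deleteInOut S T)) :
    componentVertices C = {v | componentOf S T v = C} := rfl

instance [Finite V] (S T : Set V) :
    Finite (Quiver.WeaklyConnectedComponent (deleteInOut S T)) :=
  Finite.of_surjective (componentOf S T) fun C => Quotient.inductionOn' C fun v => ⟨v, rfl⟩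

theorem componentOf_eq_of_hom {S T : Set V} {u v : V} (e : u ⟶ v) (hv : v ∉ S) (hu : u ∉ T) :
    componentOf S T u = componentOf S T v := by
  have he : e ∈ deleteInOut S T u v := by
    rintro (h | h)
    · exact hv h
    · exact hu h
  refine (Quiver.WeaklyConnectedComponent.eq (V := deleteInOut S T) u v).2 ⟨?_⟩
  exact Quiver.Path.cons Quiver.Path.nil
    (Sum.inl (⟨e, he⟩ : Quiver.Hom (V := deleteInOut S T) u v))

/-- A property of vertices that is preserved both ways along the undeleted edges is preserved
within a weak component. -/
theorem componentOf_induction {S T : Set V} {p : V → Prop} {a b : V}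
    (h : componentOf S T a = componentOf S T b) (ha : p a)
    (hp : ∀ u v : V, Nonempty (u ⟶ v) → v ∉ S → u ∉ T → (p u ↔ p v)) : p b := by
  obtain ⟨q⟩ := (Quiver.WeaklyConnectedComponent.eq (V := deleteInOut S T) a b).1 h
  induction q with
  | nil => exact ha
  | @cons c d q e ih =>
    have hc := ih (by exact (Quiver.WeaklyConnectedComponent.eq (V := deleteInOut S T) a c).2 ⟨q⟩)
    have key : ∀ (u v : V) (e : Quiver.Hom (V := deleteInOut S T) u v), p u ↔ p v := fun u v e =>
      hp u v ⟨e.1⟩ (fun hv => e.2 (Or.inl hv)) (fun hu => e.2 (Or.inr hu))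
    rcases e with e | e
    · exact (key _ _ e).1 hc
    · exact (key _ _ e).2 hc

theorem componentOf_ne_of_mem_inter {S T : Set V} {v w : V} (hS : v ∈ S) (hT : v ∈ T)
    (h : componentOf S T v = componentOf S T w) : w = v := by
  refine componentOf_induction (p := fun w => w = v) h rfl fun a b _ hb ha => ?_
  constructor
  · rintro rfl
    exact absurd hT ha
  · rintro rfl
    exact absurd hS hb

/-- A path from `a ∈ (X ∪ S ∪ T) \ T` to `b` that avoids `S ∩ T` contains two vertices of
`X ∪ S ∪ T` in one weak component, or one in the weak component of `b` with `b ∉ T`. -/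
theorem exists_pair_or_of_path {X S T : Set V} {a b : V} (p : Quiver.Path a b)
    (ha : a ∈ X ∪ S ∪ T) (haT : a ∉ T) (hn : p.vertices.Nodup)
    (hST : ∀ v ∈ p.vertices, v ∉ S ∩ T) :
    (∃ x ∈ p.vertices, ∃ y ∈ p.vertices, x ≠ y ∧ x ∈ X ∪ S ∪ T ∧ y ∈ X ∪ S ∪ T ∧
      componentOf S T x = componentOf S T y) ∨
    ∃ x ∈ p.vertices, x ∈ X ∪ S ∪ T ∧ b ∉ T ∧
      componentOf S T x = componentOf S T b := by
  induction p with
  | nil => exact Or.inr ⟨a, by simp, ha, haT, rfl⟩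
  | @cons b c p e ih =>
    simp only [Quiver.Path.vertices_cons, List.concat_eq_append, List.nodup_append,
      List.mem_append, List.mem_singleton] at hn hST ⊢
    rcases ih hn.1 (fun v hv => hST v (Or.inl hv)) with
      ⟨x, hx, y, hy, h⟩ | ⟨x, hx, hxW, hbT, hc⟩
    · exact Or.inl ⟨x, Or.inl hx, y, Or.inl hy, h⟩
    · have hxc : x ≠ c := fun h => hn.2.2 x hx c rfl h
      by_cases hcS : c ∈ S
      · exact Or.inr ⟨c, Or.inr rfl, Or.inl (Or.inr hcS),
          fun hT => hST c (Or.inr rfl) ⟨hcS, hT⟩, rfl⟩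
      · have hxc' := hc.trans (componentOf_eq_of_hom e hcS hbT)
        by_cases hcW : c ∈ X ∪ S ∪ T
        · exact Or.inl ⟨x, Or.inl hx, c, Or.inr rfl, hxc, hxW, hcW, hxc'⟩
        · exact Or.inr ⟨x, Or.inl hx, hxW, fun h => hcW (Or.inr h), hxc'⟩

theorem XPath.meets_or_exists_pair {X S T : Set V} (hX : X ∩ S = X ∩ T) (P : XPath X) :
    (∃ v ∈ P.vertexSet, v ∈ S ∩ T) ∨
      ∃ x ∈ P.vertexSet, ∃ y ∈ P.vertexSet, x ≠ y ∧ x ∈ X ∪ S ∪ T ∧ y ∈ X ∪ S ∪ T ∧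
        componentOf S T x = componentOf S T y := by
  obtain ⟨a, b, p, hn, hpos, ha, hb, -⟩ := P
  change (∃ v ∈ p.vertices, _) ∨ ∃ x ∈ p.vertices, ∃ y ∈ p.vertices, _
  by_cases hP : ∃ v ∈ p.vertices, v ∈ S ∩ T
  · exact Or.inl hP
  right
  push Not at hP
  have hXS : ∀ v ∈ X, v ∈ S ↔ v ∈ T := fun v hv => by
    simpa [hv] using Set.ext_iff.1 hX v
  have hav : ∀ v ∈ p.vertices, v ∈ X → v ∉ S ∧ v ∉ T := fun v hv hvX =>
    ⟨fun h => hP v hv ⟨h, (hXS v hvX).1 h⟩, fun h => hP v hv ⟨(hXS v hvX).2 h, h⟩⟩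
  cases p with
  | nil => simp at hpos
  | @cons c _ p e =>
    simp only [Quiver.Path.vertices_cons, List.concat_eq_append, List.nodup_append,
      List.mem_append, List.mem_singleton] at hn hP hav ⊢
    have haT := (hav a (Or.inl p.start_mem_vertices) ha).2
    have hbS := (hav b (Or.inr rfl) hb).1
    rcases exists_pair_or_of_path p (Or.inl (Or.inl ha)) haT hn.1 (fun v hv => hP v (Or.inl hv))
      with ⟨x, hx, y, hy, h⟩ | ⟨x, hx, hxW, hcT, hc⟩
    · exact ⟨x, Or.inl hx, y, Or.inl hy, h⟩
    · exact ⟨x, Or.inl hx, b, Or.inr rfl, hn.2.2 x hx b rfl, hxW, Or.inl (Or.inl hb),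
        hc.trans (componentOf_eq_of_hom e hbS hcT)⟩

end Components

section Links

variable {V : Type*} {F : V → V → Prop}

/-- From a vertex without a predecessor one reaches a sink of an injective finite partial map. -/
theorem exists_sink_of_no_pred [Finite V] (hl : Relator.LeftUnique F)
    {a : V} (ha : ∀ u, ¬ F u a) :
    ∃ t, Relation.ReflTransGen F a t ∧ ∀ v, ¬ F t v := by
  by_contra! h
  choose f hf using h
  let g : {t // Relation.ReflTransGen F a t} → {t // Relation.ReflTransGen F a t} :=
    fun t => ⟨f t.1 t.2, t.2.tail (hf t.1 t.2)⟩
  have hg : Function.Injective g := fun s t hst =>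
    Subtype.ext (hl (hf s.1 s.2) (by rw [show f s.1 s.2 = f t.1 t.2 from congrArg Subtype.val hst]
                                     exact hf t.1 t.2))
  obtain ⟨t, ht⟩ := Finite.injective_iff_surjective.1 hg ⟨a, .refl⟩
  exact ha t.1 (by
    have := hf t.1 t.2
    rwa [show f t.1 t.2 = a from congrArg Subtype.val ht] at this)

theorem eq_of_reflTransGen_of_no_pred (hl : Relator.LeftUnique F) {a b v : V}
    (ha : ∀ u, ¬ F u a) (hb : ∀ u, ¬ F u b) (hav : Relation.ReflTransGen F a v)
    (hbv : Relation.ReflTransGen F b v) : a = b := by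
  have hu : Relator.RightUnique (Function.swap F) := fun _ _ _ h h' => hl h h'
  rcases Relation.ReflTransGen.total_of_right_unique hu (Relation.reflTransGen_swap.2 hav)
    (Relation.reflTransGen_swap.2 hbv) with h | h
  · rcases Relation.ReflTransGen.cases_head h with h | ⟨c, hc, -⟩
    · exact h
    · exact absurd hc (ha c)
  · rcases Relation.ReflTransGen.cases_head h with h | ⟨c, hc, -⟩
    · exact h.symm
    · exact absurd hc (hb c)

theorem eq_of_reflTransGen_of_sink (hr : Relator.RightUnique F) {a s t : V}
    (hs : ∀ u, ¬ F s u) (ht : ∀ u, ¬ F t u) (has : Relation.ReflTransGen F a s)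
    (hat : Relation.ReflTransGen F a t) : s = t := by
  rcases Relation.ReflTransGen.total_of_right_unique hr has hat with h | h
  · rcases Relation.ReflTransGen.cases_head h with h | ⟨c, hc, -⟩
    · exact h
    · exact absurd hc (hs c)
  · rcases Relation.ReflTransGen.cases_head h with h | ⟨c, hc, -⟩
    · exact h.symm
    · exact absurd hc (ht c)

/-- In an injective partial map in which no vertex of `X` has both a predecessor and a successor,
the number of vertices of `X` with a successor is determined by the numbers of unlinked ends. -/
theorem ncard_links [Finite V] (X : Set V) (hr : Relator.RightUnique F) (hl : Relator.LeftUnique F)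
    (hX : ∀ x ∈ X, ∀ u v, F u x → ¬ F x v) :
    2 * {v | v ∈ X ∧ ∃ w, F v w}.ncard + {v | v ∈ X ∧ (∀ w, ¬ F v w) ∧ ∀ u, ¬ F u v}.ncard +
      {v | v ∉ X ∧ ∀ u, ¬ F u v}.ncard = X.ncard + {v | v ∉ X ∧ ∀ w, ¬ F v w}.ncard := by
  have hXcard : {v | v ∈ X ∧ ∃ w, F v w}.ncard + {v | v ∈ X ∧ ∃ u, F u v}.ncard +
      {v | v ∈ X ∧ (∀ w, ¬ F v w) ∧ ∀ u, ¬ F u v}.ncard = X.ncard := by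
    rw [← Set.ncard_union_eq ?_ (Set.toFinite _) (Set.toFinite _),
      ← Set.ncard_union_eq ?_ (Set.toFinite _) (Set.toFinite _)]
    · congr 1
      ext v
      simp only [Set.mem_union, Set.mem_ofPred_eq, ← not_exists]
      by_cases hv : v ∈ X <;> by_cases h₁ : ∃ w, F v w <;> by_cases h₂ : ∃ u, F u v <;>
        simp [hv, h₁, h₂]
    · rw [Set.disjoint_left]
      rintro v (⟨-, w, h⟩ | ⟨-, w, h⟩) h'
      · exact h'.2.1 w h
      · exact h'.2.2 w h
    · rw [Set.disjoint_left]
      rintro v ⟨hv, w, h⟩ ⟨-, u, h'⟩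
      exact hX v hv u w h' h
  have hdom : {v | ∃ w, F v w}.ncard + {v | v ∉ X ∧ ∀ w, ¬ F v w}.ncard =
      {v | v ∈ X ∧ ∃ w, F v w}.ncard + Xᶜ.ncard := by
    rw [← Set.ncard_union_eq ?_ (Set.toFinite _) (Set.toFinite _),
      ← Set.ncard_union_eq ?_ (Set.toFinite _) (Set.toFinite _)]
    · congr 1
      ext v
      simp only [Set.mem_union, Set.mem_ofPred_eq, ← not_exists, Set.mem_compl_iff]
      by_cases hv : v ∈ X <;> by_cases h₁ : ∃ w, F v w <;> simp [hv, h₁]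
    · exact Set.disjoint_left.2 fun v h h' => h' h.1
    · exact Set.disjoint_left.2 fun v ⟨w, h⟩ h' => h'.2 w h
  have hcod : {v | ∃ u, F u v}.ncard + {v | v ∉ X ∧ ∀ u, ¬ F u v}.ncard =
      {v | v ∈ X ∧ ∃ u, F u v}.ncard + Xᶜ.ncard := by
    rw [← Set.ncard_union_eq ?_ (Set.toFinite _) (Set.toFinite _),
      ← Set.ncard_union_eq ?_ (Set.toFinite _) (Set.toFinite _)]
    · congr 1
      ext v
      simp only [Set.mem_union, Set.mem_ofPred_eq, ← not_exists, Set.mem_compl_iff]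
      by_cases hv : v ∈ X <;> by_cases h₁ : ∃ u, F u v <;> simp [hv, h₁]
    · exact Set.disjoint_left.2 fun v h h' => h' h.1
    · exact Set.disjoint_left.2 fun v ⟨w, h⟩ h' => h'.2 w h
  have hdc : {v | ∃ w, F v w}.ncard = {v | ∃ u, F u v}.ncard :=
    Set.ncard_congr (fun v (hv : ∃ w, F v w) => hv.choose) (fun v hv => ⟨v, hv.choose_spec⟩)
      (fun u v hu hv (h : hu.choose = hv.choose) => hl hu.choose_spec (h ▸ hv.choose_spec))
      (fun w ⟨v, hv⟩ => ⟨v, ⟨w, hv⟩, hr (Exists.choose_spec (p := F v) ⟨w, hv⟩) hv⟩)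
  omega

variable [Quiver V]

theorem exists_nodup_path_of_reflTransGen (hF : ∀ u v, F u v → u ≠ v → Nonempty (u ⟶ v)) {a b : V}
    (h : Relation.ReflTransGen F a b) :
    ∃ p : Quiver.Path a b, p.vertices.Nodup ∧
      ∀ v ∈ p.vertices, Relation.ReflTransGen F a v := by
  induction h with
  | refl => exact ⟨.nil, by simp, by simpa using Relation.ReflTransGen.refl⟩
  | @tail b c hab hbc ih =>
    obtain ⟨p, hn, hp⟩ := ih
    by_cases hc : c ∈ p.vertices
    · obtain ⟨q, r, rfl⟩ := p.exists_eq_comp_of_mem_vertices hc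
      have hsub : q.vertices.Sublist (q.comp r).vertices := by
        rw [Quiver.Path.vertices_comp, ← q.dropLast_append_end_eq]
        refine List.Sublist.append (by simp) ?_
        simpa using r.start_mem_vertices
      exact ⟨q, hn.sublist hsub, fun v hv => hp v (hsub.subset hv)⟩
    · obtain ⟨e⟩ := hF b c hbc (by rintro rfl; exact hc p.end_mem_vertices)
      refine ⟨p.cons e, ?_, ?_⟩
      · rw [Quiver.Path.vertices_cons, List.concat_eq_append]
        exact List.nodup_append.2 ⟨hn, by simp, by
          simp only [List.mem_singleton, forall_eq]
          exact fun v hv h => hc (h ▸ hv)⟩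
      · intro v hv
        rcases (Quiver.Path.mem_vertices_cons p e).1 hv with hv | rfl
        · exact hp v hv
        · exact hab.tail hbc

/-- A set of links (edges, or vertices linked to themselves) forming an injective partial map in
which no vertex of `X` has both a predecessor and a successor yields `k` disjoint `X`-paths if at
least `2 * k` vertices of `X` remain after discounting the unlinked ends. -/
theorem exists_disjoint_xpaths_of_links [Finite V] (X : Set V) (k : ℕ)
    (hr : Relator.RightUnique F) (hl : Relator.LeftUnique F)
    (hF : ∀ u v, F u v → u ≠ v → Nonempty (u ⟶ v))
    (hX : ∀ x ∈ X, ∀ u v, F u x → ¬ F x v)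
    (hk : {v | v ∈ X ∧ (∀ w, ¬ F v w) ∧ ∀ u, ¬ F u v}.ncard + {v | v ∉ X ∧ ∀ w, ¬ F v w}.ncard +
      {v | v ∉ X ∧ ∀ u, ¬ F u v}.ncard + 2 * k ≤ X.ncard) :
    ∃ P : Fin k → XPath X, Pairwise fun i j => Disjoint (P i).vertexSet (P j).vertexSet := by
  classical
  have hcount := ncard_links X hr hl hX
  have hA : ∀ x ∈ {x | x ∈ X ∧ ∃ w, F x w}, ∀ u, ¬ F u x := fun x hx u hu => by
    obtain ⟨hxX, w, hw⟩ := hx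
    exact hX x hxX u w hu hw
  have hsink : ∀ x ∈ {x | x ∈ X ∧ ∃ w, F x w},
      ∃ t, Relation.ReflTransGen F x t ∧ ∀ v, ¬ F t v :=
    fun x hx => exists_sink_of_no_pred hl (hA x hx)
  have hsink' : ∀ x, ∃ t, x ∈ {x | x ∈ X ∧ ∃ w, F x w} →
      Relation.ReflTransGen F x t ∧ ∀ v, ¬ F t v := fun x => by
    by_cases hx : x ∈ {x | x ∈ X ∧ ∃ w, F x w}
    · obtain ⟨t, ht⟩ := hsink x hx
      exact ⟨t, fun _ => ht⟩
    · exact ⟨x, fun h => absurd h hx⟩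
  choose t ht using hsink'
  have hbad : ({x | x ∈ X ∧ ∃ w, F x w} ∩ {x | t x ∉ X}).ncard ≤
      {v | v ∉ X ∧ ∀ w, ¬ F v w}.ncard := by
    refine Set.ncard_le_ncard_of_injOn t (fun x hx => ⟨hx.2, (ht x hx.1).2⟩) ?_ (Set.toFinite _)
    intro x hx y hy hxy
    exact eq_of_reflTransGen_of_no_pred hl (hA x hx.1) (hA y hy.1) (ht x hx.1).1
      (hxy ▸ (ht y hy.1).1)
  have hsplit := Set.ncard_inter_add_ncard_sdiff_eq_ncard {x | x ∈ X ∧ ∃ w, F x w} {x | t x ∉ X}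
    (Set.toFinite _)
  have hgood : k ≤ ({x | x ∈ X ∧ ∃ w, F x w} \ {x | t x ∉ X}).ncard := by omega
  obtain ⟨G, hGsub, hG⟩ := Set.exists_subset_card_eq hgood
  have hcard : Nat.card G = k := hG
  let e := (Finite.equivFinOfCardEq hcard).symm
  have hpath : ∀ x : G, ∃ P : XPath X,
      ∀ v ∈ P.vertexSet, Relation.ReflTransGen F x v := by
    rintro ⟨x, hx⟩
    obtain ⟨hxA, hxt⟩ := hGsub hx
    simp only [Set.mem_ofPred_eq, not_not] at hxt
    obtain ⟨p, hn, hp⟩ := exists_nodup_path_of_reflTransGen hF (ht x hxA).1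
    refine ⟨⟨x, t x, p, hn, ?_, hxA.1, hxt, fun v hv hvX => ?_⟩, hp⟩
    · rw [Nat.pos_iff_ne_zero]
      intro h0
      obtain ⟨w, hw⟩ := hxA.2
      exact (ht x hxA).2 w (p.eq_of_length_zero h0 ▸ hw)
    · rcases Relation.ReflTransGen.cases_tail (hp v hv) with h | ⟨c, -, hc⟩
      · exact Or.inl h
      · exact Or.inr (eq_of_reflTransGen_of_sink hr (fun u => hX v hvX c u hc) (ht x hxA).2
          (hp v hv) (ht x hxA).1)
  choose P hP using hpath
  refine ⟨fun i => P (e i), fun i j hij => Set.disjoint_left.2 fun v hi hj => hij ?_⟩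
  apply e.injective
  exact Subtype.ext (eq_of_reflTransGen_of_no_pred hl (hA _ (hGsub (e i).2).1)
    (hA _ (hGsub (e j).2).1) (hP _ v hi) (hP _ v hj))

end Links

section Split

variable {V : Type*} {X : Set V} {d : ℕ}

/-- Vertices of the auxiliary graph: every vertex outside `X` is split into two copies, and `d` new
vertices are added. -/
abbrev SplitVertex (X : Set V) (d : ℕ) : Type _ := V ⊕ (↥Xᶜ ⊕ Fin d)

/-- The copy of a vertex that carries its outgoing edges. -/
def outCopy (X : Set V) (d : ℕ) (v : V) : SplitVertex X d := Sum.inl v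

open Classical in
/-- The copy of a vertex that carries its incoming edges. -/
noncomputable def inCopy (X : Set V) (d : ℕ) (v : V) : SplitVertex X d :=
  if h : v ∈ X then Sum.inl v else Sum.inr (Sum.inl ⟨v, h⟩)

/-- The new vertices. -/
def newVertex (X : Set V) (d : ℕ) (i : Fin d) : SplitVertex X d := Sum.inr (Sum.inr i)

theorem outCopy_injective : Function.Injective (outCopy X d) := Sum.inl_injective

theorem newVertex_injective : Function.Injective (newVertex X d) :=
  Sum.inr_injective.comp Sum.inr_injective

theorem inCopy_of_mem {v : V} (h : v ∈ X) : inCopy X d v = outCopy X d v := dif_pos h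

theorem inCopy_of_notMem {v : V} (h : v ∉ X) : inCopy X d v = Sum.inr (Sum.inl ⟨v, h⟩) := dif_neg h

theorem outCopy_eq_inCopy_iff {u v : V} : outCopy X d u = inCopy X d v ↔ u = v ∧ v ∈ X := by
  by_cases h : v ∈ X
  · simp [inCopy_of_mem h, outCopy_injective.eq_iff, h]
  · simp [inCopy_of_notMem h, outCopy, h]

theorem inCopy_injective : Function.Injective (inCopy X d) := by
  intro u v h
  by_cases hu : u ∈ X
  · rw [inCopy_of_mem hu] at h
    exact (outCopy_eq_inCopy_iff.1 h).1
  · by_cases hv : v ∈ X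
    · rw [inCopy_of_mem hv] at h
      exact (outCopy_eq_inCopy_iff.1 h.symm).1.symm
    · simpa [inCopy_of_notMem hu, inCopy_of_notMem hv] using h

theorem outCopy_ne_newVertex (v : V) (i : Fin d) : outCopy X d v ≠ newVertex X d i := by
  simp [outCopy, newVertex]

theorem inCopy_ne_newVertex (v : V) (i : Fin d) : inCopy X d v ≠ newVertex X d i := by
  by_cases h : v ∈ X
  · rw [inCopy_of_mem h]
    exact outCopy_ne_newVertex v i
  · simp [inCopy_of_notMem h, newVertex]

theorem SplitVertex.cases (p : SplitVertex X d) :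
    (∃ v, p = outCopy X d v) ∨ (∃ v, v ∉ X ∧ p = inCopy X d v) ∨ ∃ i, p = newVertex X d i := by
  rcases p with v | v | i
  · exact Or.inl ⟨v, rfl⟩
  · exact Or.inr (Or.inl ⟨v.1, v.2, (inCopy_of_notMem v.2).symm⟩)
  · exact Or.inr (Or.inr ⟨i, rfl⟩)

theorem ncard_eq_ncard_outCopy_add_ncard_inCopy [Finite V] (U : Set (SplitVertex X d)) :
    U.ncard = {v | outCopy X d v ∈ U}.ncard + {v | v ∉ X ∧ inCopy X d v ∈ U}.ncard +
      {i | newVertex X d i ∈ U}.ncard := by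
  have h : U = outCopy X d '' {v | outCopy X d v ∈ U} ∪
      inCopy X d '' {v | v ∉ X ∧ inCopy X d v ∈ U} ∪ newVertex X d '' {i | newVertex X d i ∈ U} := by
    ext p
    constructor
    · intro hp
      rcases p.cases with ⟨v, rfl⟩ | ⟨v, hv, rfl⟩ | ⟨i, rfl⟩
      · exact Or.inl (Or.inl ⟨v, hp, rfl⟩)
      · exact Or.inl (Or.inr ⟨v, ⟨hv, hp⟩, rfl⟩)
      · exact Or.inr ⟨i, hp, rfl⟩
    · rintro ((⟨v, hv, rfl⟩ | ⟨v, hv, rfl⟩) | ⟨i, hi, rfl⟩)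
      · exact hv
      · exact hv.2
      · exact hi
  conv_lhs => rw [h]
  rw [Set.ncard_union_eq ?_ (Set.toFinite _) (Set.toFinite _),
    Set.ncard_union_eq ?_ (Set.toFinite _) (Set.toFinite _),
    Set.ncard_image_of_injective _ outCopy_injective,
    Set.ncard_image_of_injective _ inCopy_injective,
    Set.ncard_image_of_injective _ newVertex_injective]
  · rw [Set.disjoint_left]
    rintro _ ⟨v, -, rfl⟩ ⟨w, hw, h⟩
    exact hw.1 (outCopy_eq_inCopy_iff.1 h.symm).2
  · rw [Set.disjoint_left]
    rintro _ (⟨v, -, rfl⟩ | ⟨v, -, rfl⟩) ⟨i, -, h⟩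
    · exact outCopy_ne_newVertex v i h.symm
    · exact inCopy_ne_newVertex v i h.symm

variable [Quiver V]

/-- The auxiliary graph: each edge `u ⟶ v` joins the out-copy of `u` to the in-copy of `v`, the two
copies of a vertex are adjacent, and the new vertices are adjacent to everything. -/
def splitGraph (X : Set V) (d : ℕ) : SimpleGraph (SplitVertex X d) :=
  SimpleGraph.fromRel fun p q =>
    (∃ u v, p = outCopy X d u ∧ q = inCopy X d v ∧ (Nonempty (u ⟶ v) ∨ u = v)) ∨
      ∃ i, p = newVertex X d i

theorem splitGraph_adj_cases {p q : SplitVertex X d} (h : (splitGraph X d).Adj p q) :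
    (∃ u v, (Nonempty (u ⟶ v) ∨ u = v) ∧
      (p = outCopy X d u ∧ q = inCopy X d v ∨ q = outCopy X d u ∧ p = inCopy X d v)) ∨
    (∃ i, p = newVertex X d i) ∨ ∃ i, q = newVertex X d i := by
  obtain ⟨-, (⟨u, v, hp, hq, h⟩ | h) | (⟨u, v, hp, hq, h⟩ | h)⟩ :=
    (SimpleGraph.fromRel_adj _ _ _).1 h
  · exact Or.inl ⟨u, v, h, Or.inl ⟨hp, hq⟩⟩
  · exact Or.inr (Or.inl h)
  · exact Or.inl ⟨u, v, h, Or.inr ⟨hp, hq⟩⟩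
  · exact Or.inr (Or.inr h)

theorem splitGraph_adj_of_link {u v : V} (h : Nonempty (u ⟶ v) ∨ u = v)
    (hne : outCopy X d u ≠ inCopy X d v) :
    (splitGraph X d).Adj (outCopy X d u) (inCopy X d v) :=
  (SimpleGraph.fromRel_adj _ _ _).2 ⟨hne, Or.inl (Or.inl ⟨u, v, rfl, rfl, h⟩)⟩

theorem splitGraph_adj_newVertex {p : SplitVertex X d} {i : Fin d} (h : p ≠ newVertex X d i) :
    (splitGraph X d).Adj p (newVertex X d i) :=
  (SimpleGraph.fromRel_adj _ _ _).2 ⟨h, Or.inr (Or.inr ⟨i, rfl⟩)⟩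

/-- A perfect matching of the auxiliary graph with `|X| - 2k` new vertices yields `k` disjoint
`X`-paths. -/
theorem exists_disjoint_xpaths_of_isPerfectMatching [Finite V] (k : ℕ) (hd : d + 2 * k = X.ncard)
    {M : (splitGraph X d).Subgraph} (hM : M.IsPerfectMatching) :
    ∃ P : Fin k → XPath X, Pairwise fun i j => Disjoint (P i).vertexSet (P j).vertexSet := by
  rw [SimpleGraph.Subgraph.isPerfectMatching_iff] at hM
  choose m hm hmu using hM
  have hmm : ∀ {p q}, M.Adj p q → q = m p := fun h => hmu _ _ h
  have hinv : ∀ p, m (m p) = p := fun p => (hmm (hm p).symm).symm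
  have hminj : Function.Injective m := Function.LeftInverse.injective hinv
  obtain ⟨n, ⟨e⟩⟩ := Finite.exists_equiv_fin V
  let F : V → V → Prop := fun u v => m (outCopy X d u) = inCopy X d v ∧
    (Nonempty (u ⟶ v) ∨ u = v) ∧ (u ∈ X → v ∈ X → Nonempty (v ⟶ u) → e u < e v)
  have hr : Relator.RightUnique F := fun u v w hv hw => inCopy_injective (hv.1.symm.trans hw.1)
  have hl : Relator.LeftUnique F := fun u v w hu hv =>
    outCopy_injective (hminj (hu.1.trans hv.1.symm))
  have hmne : ∀ p, m p ≠ p := fun p h => (hm p).ne h.symm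
  have hX : ∀ x ∈ X, ∀ u v, F u x → ¬ F x v := by
    intro x hx u v hu hv
    have h1 : inCopy X d v = outCopy X d u := by
      rw [← hv.1, ← inCopy_of_mem hx, ← hu.1, hinv]
    obtain ⟨rfl, hvX⟩ := outCopy_eq_inCopy_iff.1 h1.symm
    have hne : u ≠ x := by
      rintro rfl
      have := hu.1
      rw [inCopy_of_mem hx] at this
      exact hmne _ this
    have h2 := hu.2.2 hvX hx (hv.2.1.resolve_right hne.symm)
    have h3 := hv.2.2 hx hvX (hu.2.1.resolve_right hne)
    exact lt_asymm h2 h3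
  have hcases : ∀ p, (∃ u v, (Nonempty (u ⟶ v) ∨ u = v) ∧
      (p = outCopy X d u ∧ m p = inCopy X d v ∨ m p = outCopy X d u ∧ p = inCopy X d v)) ∨
      (∃ i, p = newVertex X d i) ∨ ∃ i, m p = newVertex X d i :=
    fun p => splitGraph_adj_cases (hm p).adj_sub
  have hlink : ∀ u v, (Nonempty (u ⟶ v) ∨ u = v) → m (outCopy X d u) = inCopy X d v →
      F u v ∨ (u ∈ X ∧ v ∈ X ∧ F v u) := by
    intro u v h hmuv
    by_cases h' : u ∈ X → v ∈ X → Nonempty (v ⟶ u) → e u < e v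
    · exact Or.inl ⟨hmuv, h, h'⟩
    · push Not at h'
      obtain ⟨huX, hvX, hvu, hle⟩ := h'
      have hne : u ≠ v := by
        rintro rfl
        rw [inCopy_of_mem huX] at hmuv
        exact hmne _ hmuv
      refine Or.inr ⟨huX, hvX, ?_, Or.inl hvu, fun _ _ _ =>
        lt_of_le_of_ne hle (fun h => hne (e.injective h).symm)⟩
      rw [← inCopy_of_mem hvX, ← hmuv, hinv, inCopy_of_mem huX]
  have hout : ∀ v, v ∉ X → (∀ w, ¬ F v w) → ∃ i, m (outCopy X d v) = newVertex X d i := by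
    intro v hv hno
    rcases hcases (outCopy X d v) with ⟨a, b, h, ⟨hp, hq⟩ | ⟨hp, hq⟩⟩ | ⟨i, h⟩ | h
    · obtain rfl := outCopy_injective hp
      rcases hlink _ _ h hq with h | h
      · exact absurd h (hno b)
      · exact absurd h.1 hv
    · obtain ⟨rfl, h⟩ := outCopy_eq_inCopy_iff.1 hq
      exact absurd h hv
    · exact absurd h (outCopy_ne_newVertex v i)
    · exact h
  have hin : ∀ v, v ∉ X → (∀ u, ¬ F u v) → ∃ i, m (inCopy X d v) = newVertex X d i := by
    intro v hv hno
    rcases hcases (inCopy X d v) with ⟨a, b, h, ⟨hp, hq⟩ | ⟨hp, hq⟩⟩ | ⟨i, h⟩ | h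
    · exact absurd (outCopy_eq_inCopy_iff.1 hp.symm).2 hv
    · obtain rfl := inCopy_injective hq
      rcases hlink a v h (by rw [← hp, hinv]) with h | h
      · exact absurd h (hno a)
      · exact absurd h.2.1 hv
    · exact absurd h (inCopy_ne_newVertex v i)
    · exact h
  have hfree : ∀ v, v ∈ X → (∀ w, ¬ F v w) → (∀ u, ¬ F u v) →
      ∃ i, m (outCopy X d v) = newVertex X d i := by
    intro v hv hs hp
    rcases hcases (outCopy X d v) with ⟨a, b, h, ⟨ha, hb⟩ | ⟨ha, hb⟩⟩ | ⟨i, h⟩ | h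
    · obtain rfl := outCopy_injective ha
      rcases hlink _ _ h hb with h | h
      · exact absurd h (hs b)
      · exact absurd h.2.2 (hp b)
    · obtain ⟨rfl, -⟩ := outCopy_eq_inCopy_iff.1 hb
      rcases hlink a v h (by rw [← ha, hinv, inCopy_of_mem hv]) with h | h
      · exact absurd h (hp a)
      · exact absurd h.2.2 (hs a)
    · exact absurd h (outCopy_ne_newVertex v i)
    · exact h
  have hnew : {v | v ∈ X ∧ (∀ w, ¬ F v w) ∧ ∀ u, ¬ F u v}.ncard +
      {v | v ∉ X ∧ ∀ w, ¬ F v w}.ncard + {v | v ∉ X ∧ ∀ u, ¬ F u v}.ncard ≤ d := by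
    rw [← Set.ncard_union_eq (Set.disjoint_left.2 fun v h h' => h'.1 h.1) (Set.toFinite _)
      (Set.toFinite _), ← Set.ncard_image_of_injective _ (outCopy_injective (X := X) (d := d)),
      ← Set.ncard_image_of_injective {v | v ∉ X ∧ ∀ u, ¬ F u v} (inCopy_injective (X := X) (d := d)),
      ← Set.ncard_union_eq ?_ (Set.toFinite _) (Set.toFinite _)]
    · have hrange : (Set.range (newVertex X d)).ncard = d := by
        rw [← Set.image_univ, Set.ncard_image_of_injective _ newVertex_injective, Set.ncard_univ,
          Nat.card_eq_fintype_card, Fintype.card_fin]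
      conv_rhs => rw [← hrange]
      refine Set.ncard_le_ncard_of_injOn m ?_ hminj.injOn (Set.toFinite _)
      rintro _ (⟨v, h | h, rfl⟩ | ⟨v, h, rfl⟩)
      · obtain ⟨i, hi⟩ := hfree v h.1 h.2.1 h.2.2
        exact ⟨i, hi.symm⟩
      · obtain ⟨i, hi⟩ := hout v h.1 h.2
        exact ⟨i, hi.symm⟩
      · obtain ⟨i, hi⟩ := hin v h.1 h.2
        exact ⟨i, hi.symm⟩
    · rw [Set.disjoint_left]
      rintro _ ⟨v, -, rfl⟩ ⟨w, hw, h⟩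
      exact hw.1 (outCopy_eq_inCopy_iff.1 h.symm).2
  exact exists_disjoint_xpaths_of_links X k hr hl
    (fun u v h hne => h.2.1.resolve_right hne) hX (by omega)

end Split

theorem odd_ncard_inter_iff {V : Type*} [Finite V] {X S T A : Set V} (hX : X ∩ S = X ∩ T)
    (hA : Disjoint A (S ∩ T)) :
    Odd ((A \ T).ncard + (A \ (X ∪ S)).ncard) ↔ Odd (A ∩ (X ∪ S ∪ T)).ncard := by
  have hXS : ∀ v ∈ X, v ∈ S ↔ v ∈ T := fun v hv => by
    simpa [hv] using Set.ext_iff.1 hX v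
  have hA' : ∀ v ∈ A, v ∈ S → v ∉ T := fun v hv hS hT => Set.disjoint_left.1 hA hv ⟨hS, hT⟩
  have h1 : A \ T = (A \ (X ∪ S ∪ T)) ∪ (A ∩ ((X ∪ S) \ T)) := by
    ext v
    simp only [Set.mem_sdiff, Set.mem_union, Set.mem_inter_iff]
    tauto
  have h2 : A \ (X ∪ S) = (A \ (X ∪ S ∪ T)) ∪ (A ∩ T) := by
    ext v
    have := hXS v
    have := hA' v
    simp only [Set.mem_sdiff, Set.mem_union, Set.mem_inter_iff]
    tauto
  have h3 : A ∩ (X ∪ S ∪ T) = (A ∩ ((X ∪ S) \ T)) ∪ (A ∩ T) := by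
    ext v
    simp only [Set.mem_sdiff, Set.mem_union, Set.mem_inter_iff]
    tauto
  rw [h1, h2, h3, Set.ncard_union_eq ?_ (Set.toFinite _) (Set.toFinite _),
    Set.ncard_union_eq ?_ (Set.toFinite _) (Set.toFinite _),
    Set.ncard_union_eq ?_ (Set.toFinite _) (Set.toFinite _)]
  · rw [Nat.odd_iff, Nat.odd_iff]
    omega
  · exact Set.disjoint_left.2 fun v h h' => h.2.2 h'.2
  · exact Set.disjoint_left.2 fun v h h' => h.2 (Or.inr h'.2)
  · exact Set.disjoint_left.2 fun v h h' => h.2 (Or.inl h'.2.1)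

section Tutte

variable {V : Type*} {X : Set V} {d : ℕ}

/-- `p` is a copy of `v`. -/
def IsCopy (p : SplitVertex X d) (v : V) : Prop := p = outCopy X d v ∨ p = inCopy X d v

theorem IsCopy.unique {p : SplitVertex X d} {u v : V} (hu : IsCopy p u) (hv : IsCopy p v) :
    u = v := by
  rcases hu with rfl | rfl <;> rcases hv with h | h
  · exact outCopy_injective h
  · exact (outCopy_eq_inCopy_iff.1 h).1
  · exact (outCopy_eq_inCopy_iff.1 h.symm).1.symm
  · exact inCopy_injective h

theorem inter_outCopy_eq (U : Set (SplitVertex X d)) :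
    X ∩ {v | inCopy X d v ∈ U} = X ∩ {v | outCopy X d v ∈ U} := by
  ext v
  refine and_congr_right fun hv => ?_
  simp [inCopy_of_mem hv]

variable [Quiver V]

/-- The auxiliary graph without the vertices in `U`. -/
abbrev restGraph (U : Set (SplitVertex X d)) :
    SimpleGraph ((⊤ : (splitGraph X d).Subgraph).deleteVerts U).verts :=
  ((⊤ : (splitGraph X d).Subgraph).deleteVerts U).coe

theorem notMem_of_restGraph {U : Set (SplitVertex X d)}
    (p : ((⊤ : (splitGraph X d).Subgraph).deleteVerts U).verts) : p.1 ∉ U := p.2.2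

theorem restGraph_adj {U : Set (SplitVertex X d)}
    {p q : ((⊤ : (splitGraph X d).Subgraph).deleteVerts U).verts} :
    (restGraph U).Adj p q ↔ (splitGraph X d).Adj p.1 q.1 := by
  rw [SimpleGraph.Subgraph.coe_adj, SimpleGraph.Subgraph.deleteVerts_adj]
  simp [notMem_of_restGraph p, notMem_of_restGraph q]

theorem reachable_of_link {U : Set (SplitVertex X d)} {u v : V} (h : Nonempty (u ⟶ v) ∨ u = v)
    {p q : ((⊤ : (splitGraph X d).Subgraph).deleteVerts U).verts}
    (hp : p.1 = outCopy X d u) (hq : q.1 = inCopy X d v) : (restGraph U).Reachable p q := by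
  by_cases hne : p = q
  · rw [hne]
  · refine SimpleGraph.Adj.reachable (restGraph_adj.2 ?_)
    rw [hp, hq]
    exact splitGraph_adj_of_link h fun h => hne (Subtype.ext (by rw [hp, hq, h]))

theorem reachable_of_isCopy {U : Set (SplitVertex X d)} {v : V}
    {p q : ((⊤ : (splitGraph X d).Subgraph).deleteVerts U).verts}
    (hp : IsCopy p.1 v) (hq : IsCopy q.1 v) : (restGraph U).Reachable p q := by
  rcases hp with hp | hp <;> rcases hq with hq | hq
  · rw [Subtype.ext (hp.trans hq.symm)]
  · exact reachable_of_link (Or.inr rfl) hp hq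
  · exact (reachable_of_link (Or.inr rfl) hq hp).symm
  · rw [Subtype.ext (hp.trans hq.symm)]

theorem reachable_of_componentOf_eq {U : Set (SplitVertex X d)} {u v : V}
    (h : componentOf {v | inCopy X d v ∈ U} {v | outCopy X d v ∈ U} u =
      componentOf {v | inCopy X d v ∈ U} {v | outCopy X d v ∈ U} v)
    {p q : ((⊤ : (splitGraph X d).Subgraph).deleteVerts U).verts}
    (hp : IsCopy p.1 u) (hq : IsCopy q.1 v) : (restGraph U).Reachable p q := by
  refine componentOf_induction
    (p := fun v => ∀ q : ((⊤ : (splitGraph X d).Subgraph).deleteVerts U).verts,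
      IsCopy q.1 v → (restGraph U).Reachable p q) h (fun q hq => reachable_of_isCopy hp hq)
    (fun a b hab hb ha => ?_) q hq
  let a' : ((⊤ : (splitGraph X d).Subgraph).deleteVerts U).verts := ⟨outCopy X d a, trivial, ha⟩
  let b' : ((⊤ : (splitGraph X d).Subgraph).deleteVerts U).verts := ⟨inCopy X d b, trivial, hb⟩
  have hlink : (restGraph U).Reachable a' b' := reachable_of_link (Or.inl hab) rfl rfl
  constructor
  · intro h q hq
    exact ((h a' (Or.inl rfl)).trans hlink).trans (reachable_of_isCopy (Or.inr rfl) hq)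
  · intro h q hq
    exact ((h b' (Or.inr rfl)).trans hlink.symm).trans (reachable_of_isCopy (Or.inl rfl) hq)

theorem componentOf_eq_of_reachable {U : Set (SplitVertex X d)} (hU : ∀ i, newVertex X d i ∈ U)
    {p q : ((⊤ : (splitGraph X d).Subgraph).deleteVerts U).verts}
    (h : (restGraph U).Reachable p q) {u v : V} (hp : IsCopy p.1 u) (hq : IsCopy q.1 v) :
    componentOf {v | inCopy X d v ∈ U} {v | outCopy X d v ∈ U} u =
      componentOf {v | inCopy X d v ∈ U} {v | outCopy X d v ∈ U} v := by
  obtain ⟨w⟩ := h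
  induction w generalizing u with
  | nil => rw [hp.unique hq]
  | @cons p r q hpr w ih =>
    have hnew : ∀ (s : ((⊤ : (splitGraph X d).Subgraph).deleteVerts U).verts) i,
        s.1 ≠ newVertex X d i := fun s i h => notMem_of_restGraph s (h ▸ hU i)
    rcases splitGraph_adj_cases (restGraph_adj.1 hpr) with
      ⟨a, b, h, h'⟩ | ⟨i, h⟩ | ⟨i, h⟩
    · have key : outCopy X d a ∉ U → inCopy X d b ∉ U →
          componentOf {v | inCopy X d v ∈ U} {v | outCopy X d v ∈ U} a =
            componentOf {v | inCopy X d v ∈ U} {v | outCopy X d v ∈ U} b := fun ha hb => by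
        rcases h with ⟨⟨e⟩⟩ | rfl
        · exact componentOf_eq_of_hom e hb ha
        · rfl
      have hpU := notMem_of_restGraph p
      have hrU := notMem_of_restGraph r
      rcases h' with ⟨h1, h2⟩ | ⟨h1, h2⟩
      · obtain rfl := hp.unique (Or.inl h1)
        exact (key (h1 ▸ hpU) (h2 ▸ hrU)).trans (ih (Or.inr h2) hq)
      · obtain rfl := hp.unique (Or.inr h2)
        exact (key (h1 ▸ hrU) (h2 ▸ hpU)).symm.trans (ih (Or.inl h1) hq)
    · exact absurd h (hnew p i)
    · exact absurd h (hnew r i)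

theorem exists_isCopy {U : Set (SplitVertex X d)} (hU : ∀ i, newVertex X d i ∈ U)
    (p : ((⊤ : (splitGraph X d).Subgraph).deleteVerts U).verts) : ∃ v, IsCopy p.1 v := by
  rcases p.1.cases with ⟨v, h⟩ | ⟨v, -, h⟩ | ⟨i, h⟩
  · exact ⟨v, Or.inl h⟩
  · exact ⟨v, Or.inr h⟩
  · exact absurd (h ▸ hU i) (notMem_of_restGraph p)

/-- A component of the auxiliary graph has the parity of the number of vertices of `X ∪ S ∪ T` in
the corresponding weak component. -/
theorem odd_ncard_supp_iff [Finite V] {U : Set (SplitVertex X d)} (hU : ∀ i, newVertex X d i ∈ U)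
    (p : ((⊤ : (splitGraph X d).Subgraph).deleteVerts U).verts) {v : V} (hp : IsCopy p.1 v) :
    Odd ((restGraph U).connectedComponentMk p).supp.ncard ↔
      Odd ({w | componentOf {v | inCopy X d v ∈ U} {v | outCopy X d v ∈ U} w =
        componentOf {v | inCopy X d v ∈ U} {v | outCopy X d v ∈ U} v} ∩
          (X ∪ {v | inCopy X d v ∈ U} ∪ {v | outCopy X d v ∈ U})).ncard := by
  have hmem : ∀ (q : SplitVertex X d) (w : V), IsCopy q w →
      (q ∈ Subtype.val '' ((restGraph U).connectedComponentMk p).supp ↔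
        componentOf {v | inCopy X d v ∈ U} {v | outCopy X d v ∈ U} w =
          componentOf {v | inCopy X d v ∈ U} {v | outCopy X d v ∈ U} v ∧ q ∉ U) := by
    intro q w hq
    constructor
    · rintro ⟨q, hq', rfl⟩
      rw [SimpleGraph.ConnectedComponent.mem_supp_iff, SimpleGraph.ConnectedComponent.eq] at hq'
      exact ⟨componentOf_eq_of_reachable hU hq' hq hp, notMem_of_restGraph q⟩
    · rintro ⟨h, hqU⟩
      refine ⟨⟨q, trivial, hqU⟩, ?_, rfl⟩
      rw [SimpleGraph.ConnectedComponent.mem_supp_iff, SimpleGraph.ConnectedComponent.eq]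
      exact reachable_of_componentOf_eq h hq hp
  rw [← odd_ncard_inter_iff (inter_outCopy_eq U),
    ← Set.ncard_image_of_injective _ Subtype.val_injective,
    ncard_eq_ncard_outCopy_add_ncard_inCopy]
  · have h0 : {i | newVertex X d i ∈ Subtype.val ''
        ((restGraph U).connectedComponentMk p).supp} = ∅ := by
      ext i
      simp only [Set.mem_ofPred_eq, Set.mem_empty_iff_false, iff_false]
      rintro ⟨q, -, h⟩
      exact notMem_of_restGraph q (h ▸ hU i)
    rw [h0, Set.ncard_empty, add_zero]
    convert Iff.rfl using 4
    · ext w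
      exact (hmem _ w (Or.inl rfl)).symm
    · ext w
      simp only [Set.mem_ofPred_eq, Set.mem_sdiff, Set.mem_union, hmem _ w (Or.inr rfl)]
      tauto
  · rw [Set.disjoint_left]
    rintro w hw ⟨hS, hT⟩
    obtain rfl := componentOf_ne_of_mem_inter hS hT hw
    rcases hp with hp | hp
    · exact notMem_of_restGraph p (hp ▸ hT)
    · exact notMem_of_restGraph p (hp ▸ hS)

theorem ncard_oddComponents_add_le [Finite V] {U : Set (SplitVertex X d)}
    (hU : ∀ i, newVertex X d i ∈ U) :
    (restGraph U).oddComponents.ncard + ({v | inCopy X d v ∈ U} ∩ {v | outCopy X d v ∈ U}).ncard ≤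
      {c | Odd ({w | componentOf {v | inCopy X d v ∈ U} {v | outCopy X d v ∈ U} w = c} ∩
        (X ∪ {v | inCopy X d v ∈ U} ∪ {v | outCopy X d v ∈ U})).ncard}.ncard := by
  have hrep : ∀ c : (restGraph U).ConnectedComponent, ∃ p v,
      (restGraph U).connectedComponentMk p = c ∧ IsCopy p.1 v := fun c => by
    obtain ⟨p, rfl⟩ := c.exists_rep
    obtain ⟨v, hv⟩ := exists_isCopy hU p
    exact ⟨p, v, rfl, hv⟩
  choose p v hpc hpv using hrep
  set f := componentOf {v | inCopy X d v ∈ U} {v | outCopy X d v ∈ U} with hf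
  have hvinj : Function.Injective fun c => f (v c) := fun c c' h => by
    rw [← hpc c, ← hpc c', SimpleGraph.ConnectedComponent.eq]
    exact reachable_of_componentOf_eq h (hpv c) (hpv c')
  have hfinj : Set.InjOn f ({v | inCopy X d v ∈ U} ∩ {v | outCopy X d v ∈ U}) :=
    fun a ha b _ h => (componentOf_ne_of_mem_inter ha.1 ha.2 h).symm
  rw [← Set.ncard_image_of_injective _ hvinj, ← hfinj.ncard_image,
    ← Set.ncard_union_eq ?_ (Set.toFinite _) (Set.toFinite _)]
  · refine Set.ncard_le_ncard ?_ (Set.toFinite _)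
    rintro _ (⟨c, hc, rfl⟩ | ⟨a, ha, rfl⟩)
    · have := (odd_ncard_supp_iff hU (p c) (hpv c)).1 (by rw [hpc c]; exact hc)
      exact this
    · have : {w | f w = f a} ∩ (X ∪ {v | inCopy X d v ∈ U} ∪ {v | outCopy X d v ∈ U}) = {a} := by
        ext w
        constructor
        · exact fun h => componentOf_ne_of_mem_inter ha.1 ha.2 h.1.symm
        · rintro rfl
          exact ⟨rfl, Or.inr ha.2⟩
      rw [Set.mem_ofPred_eq, this, Set.ncard_singleton]
      exact odd_one
  · rw [Set.disjoint_left]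
    rintro _ ⟨c, -, rfl⟩ ⟨a, ha, h⟩
    have hva := componentOf_ne_of_mem_inter ha.1 ha.2 h
    have := notMem_of_restGraph (p c)
    rcases hpv c with h | h <;> rw [h, hva] at this
    · exact this ha.2
    · exact this ha.1

theorem exists_isPerfectMatching_splitGraph [Finite V] (k : ℕ) (hd : d + 2 * k = X.ncard)
    (h : ∀ S T : Set V, X ∩ S = X ∩ T →
      k ≤ (S ∩ T).ncard +
        ∑ᶠ C : Quiver.WeaklyConnectedComponent (deleteInOut S T),
          ((componentVertices C ∩ (X ∪ S ∪ T)).ncard / 2)) :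
    ∃ M : (splitGraph X d).Subgraph, M.IsPerfectMatching := by
  refine SimpleGraph.tutte.2 fun U => ?_
  rw [SimpleGraph.IsTutteViolator, not_lt]
  change (restGraph U).oddComponents.ncard ≤ _
  by_cases hU : ∀ i, newVertex X d i ∈ U
  · set S := {v | inCopy X d v ∈ U} with hS
    set T := {v | outCopy X d v ∈ U} with hT
    have hST : X ∩ S = X ∩ T := inter_outCopy_eq U
    have h1 := card_odd_classes_le (componentOf S T) (X ∪ S ∪ T) k _ (h S T hST)
    have h2 := ncard_oddComponents_add_le hU
    have h3 := ncard_eq_ncard_outCopy_add_ncard_inCopy U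
    have h4 : {i | newVertex X d i ∈ U}.ncard = d := by
      simp [hU]
    have h5 : (X ∪ T).ncard + (S \ X).ncard = (X ∪ S ∪ T).ncard + ((S ∩ T) \ X).ncard := by
      rw [← Set.ncard_union_add_ncard_inter (X ∪ T) (S \ X)]
      congr 2 <;> ext v <;>
        simp only [Set.mem_union, Set.mem_sdiff, Set.mem_inter_iff] <;> tauto
    have h6 := Set.ncard_union_add_ncard_inter X T
    have h7 := Set.ncard_inter_add_ncard_sdiff_eq_ncard (S ∩ T) X (Set.toFinite _)
    have h8 : S ∩ T ∩ X = X ∩ T := by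
      rw [Set.inter_comm, ← Set.inter_assoc, hST, Set.inter_assoc, Set.inter_self]
    have h9 : {v | v ∉ X ∧ inCopy X d v ∈ U} = S \ X := by
      ext v
      exact and_comm
    rw [h8] at h7
    rw [h4, h9, ← hT] at h3
    rw [← hS, ← hT] at h2
    omega
  · push Not at hU
    obtain ⟨i, hi⟩ := hU
    let n : ((⊤ : (splitGraph X d).Subgraph).deleteVerts U).verts := ⟨newVertex X d i, trivial, hi⟩
    have hreach : ∀ p, (restGraph U).Reachable p n := fun p => by
      by_cases hp : p = n
      · rw [hp]
      · exact SimpleGraph.Adj.reachable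
          (restGraph_adj.2 (splitGraph_adj_newVertex fun h => hp (Subtype.ext h)))
    have hle : (restGraph U).oddComponents.ncard ≤ 1 := by
      rw [Set.ncard_le_one (Set.toFinite _)]
      intro a _ b _
      obtain ⟨p, rfl⟩ := a.exists_rep
      obtain ⟨q, rfl⟩ := b.exists_rep
      exact SimpleGraph.ConnectedComponent.eq.2 ((hreach p).trans (hreach q).symm)
    rcases U.eq_empty_or_nonempty with rfl | hne
    · have hc : Nat.card ((⊤ : (splitGraph X d).Subgraph).deleteVerts ∅).verts =
          Nat.card V + (Xᶜ.ncard + d) := by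
        have : ((⊤ : (splitGraph X d).Subgraph).deleteVerts ∅).verts = Set.univ := by simp
        rw [this, Nat.card_univ, Nat.card_sum, Nat.card_sum, Nat.card_coe_set_eq, Nat.card_fin]
      have hX := Set.ncard_add_ncard_compl X
      have hodd := (SimpleGraph.odd_ncard_oddComponents (restGraph (X := X) (d := d) ∅)).not
      rw [hc, Nat.odd_iff, Nat.odd_iff] at hodd
      have : ¬ (Nat.card V + (Xᶜ.ncard + d)) % 2 = 1 := by omega
      have := hodd.2 this
      omega
    · exact hle.trans ((Set.ncard_pos (Set.toFinite _)).2 hne)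

end Tutte

end DirMultigraph

theorem corollary5p1 {V : Type*} [Finite V] [Quiver V] (X : Set V) (k : ℕ) :
    (∃ P : Fin k → DirMultigraph.XPath X,
      Pairwise fun i j => Disjoint (P i).vertexSet (P j).vertexSet) ↔
    ∀ S T : Set V, X ∩ S = X ∩ T →
      k ≤ (S ∩ T).ncard +
        ∑ᶠ C : Quiver.WeaklyConnectedComponent (DirMultigraph.deleteInOut S T),
          ((DirMultigraph.componentVertices C ∩ (X ∪ S ∪ T)).ncard / 2) := by
  constructor
  · rintro ⟨P, hP⟩ S T hST
    simpa [DirMultigraph.componentVertices_eq] using DirMultigraph.card_le_of_disjoint_family (DirMultigraph.componentOf S T) (S ∩ T)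
      (X ∪ S ∪ T) (fun i => (P i).vertexSet) hP fun i => (P i).meets_or_exists_pair hST
  · intro h
    have hk : 2 * k ≤ X.ncard := by
      have := DirMultigraph.card_odd_classes_le (DirMultigraph.componentOf ∅ ∅) (X ∪ ∅ ∪ ∅) k _
        (h ∅ ∅ rfl)
      simp only [Set.union_empty, Set.inter_empty, Set.ncard_empty] at this
      omega
    obtain ⟨M, hM⟩ := DirMultigraph.exists_isPerfectMatching_splitGraph k
      (Nat.sub_add_cancel hk) h
    exact DirMultigraph.exists_disjoint_xpaths_of_isPerfectMatching k (Nat.sub_add_cancel hk) hM
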